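/- For a finite simple graph $G$, let $m$ be the number of its edges, let its average degree be $\frac{1}{|V(G)|}\sum_{v\in V(G)}\deg(v)$, and let the number of cycles of $G$ be the number of subgraphs of $G$ that are cycles (of length at least $3$). (1) There is an absolute constant $C$ such that every finite simple graph with $m$ edges, without isolated vertices and with average degree at most $4$ (in particular, with average degree exactly $4$) has at most $C\cdot 1.365^{m}$ cycles. (2) There is an integer $m_0$ such that every finite $4$-regular simple graph with $m\ge m_0$ edges has at most $1.99^{m/2}$ cycles. -/

import Mathlib

universe u

namespace SimpleGraph

/-- The number of cycles of `G`: a cycle is a subgraph traced out by some closed walk that is a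
cycle (so the starting vertex and the direction of traversal do not matter). -/
noncomputable def numCycles {V : Type u} (G : SimpleGraph V) : ℕ :=
  {H : G.Subgraph | ∃ (v : V) (p : G.Walk v v), p.IsCycle ∧ p.toSubgraph = H}.ncard

/-- The average degree of a finite graph. -/
noncomputable def averageDegree {V : Type u} [Fintype V] (G : SimpleGraph V)
    [DecidableRel G.Adj] : ℝ :=
  (∑ v : V, (G.degree v : ℝ)) / (Fintype.card V : ℝ)

end SimpleGraph

namespace CycleBound

/-! ### The weights -/

/-! Opening a cycle at one of its directed edges leaves a path, so it suffices to count
self-avoiding routes to a target `s`. A state of the search is the set `U` of unvisited vertices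
together with the multiplicities `m` of the links from the current vertex into `U`.

`linkedPathCount_le` bounds the routes by a potential: `linkWeight` of the number of links times a
product of local weights over `U` without `s`. Dead ends are deleted. A singly linked vertex with
one unvisited neighbour is suppressed, its weight 1.0755 passing to that neighbour. Otherwise the
search branches, and the potential survives by `sum_mul_prod_vertexWeight_le`. That inequality is
reduced to families of three extremal vertex types, where contractions multiply and gains add; what
remains is `contraction_mul_gain_le`, a finite check with a monotone tail.

At the start the potential is at most a constant times the product of `vertexWeight` over all
degrees. Since `vertexWeight` lies below a geometric function of ratio 1.23 exact from degree 4 on,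
average degree at most 4 bounds the product by 1.8629 to the power m/2, and the square root of
1.8629 is below 1.3649. The remaining factor, linear in m, fits into the gap up to 1.365. -/

/-- The weight of an unvisited vertex of degree `d`. -/
noncomputable def vertexWeight : ℕ → ℝ
  | 0 => 1
  | 1 => 1
  | 2 => 1.0755
  | 3 => 1.467
  | n + 4 => 1.8629 * 1.23 ^ n

/-- The weight of the current vertex when it has `k` links to unvisited vertices. -/
noncomputable def linkWeight : ℕ → ℝ
  | 0 => 0
  | 1 => 1
  | 2 => 1.362
  | 3 => 1.6
  | n + 4 => 1.49032 * 1.23 ^ (n + 1)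

/-- The weight of an unvisited vertex with `e` unvisited neighbours and `m` links to the current
vertex; every link beyond the first accounts for a suppressed vertex of degree two. -/
noncomputable def linkedWeight (e m : ℕ) : ℝ :=
  vertexWeight (e + m) * 1.0755 ^ (m - 1)

lemma vertexWeight_le_succ (d : ℕ) : vertexWeight d ≤ vertexWeight (d + 1) := by
  match d with
  | 0 | 1 | 2 | 3 => norm_num [vertexWeight]
  | n + 4 =>
    simp only [vertexWeight, pow_succ]
    have : (0 : ℝ) < 1.23 ^ n := by positivity
    linarith

lemma vertexWeight_mono : Monotone vertexWeight :=
  monotone_nat_of_le_succ vertexWeight_le_succ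

lemma one_le_vertexWeight (d : ℕ) : 1 ≤ vertexWeight d :=
  vertexWeight_mono (Nat.zero_le d)

lemma vertexWeight_pos (d : ℕ) : 0 < vertexWeight d :=
  zero_lt_one.trans_le (one_le_vertexWeight d)

lemma one_le_linkedWeight (e m : ℕ) : 1 ≤ linkedWeight e m :=
  one_le_mul_of_one_le_of_one_le (one_le_vertexWeight _) (one_le_pow₀ (by norm_num))

lemma linkedWeight_pos (e m : ℕ) : 0 < linkedWeight e m :=
  zero_lt_one.trans_le (one_le_linkedWeight e m)

lemma linkedWeight_mono_left {e e' : ℕ} (h : e ≤ e') (m : ℕ) :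
    linkedWeight e m ≤ linkedWeight e' m := by
  unfold linkedWeight
  gcongr
  exact vertexWeight_mono (by omega)

lemma linkedWeight_of_le_one (e : ℕ) {m : ℕ} (hm : m ≤ 1) :
    linkedWeight e m = vertexWeight (e + m) := by
  simp [linkedWeight, Nat.sub_eq_zero_of_le hm]

/-- The price of suppression: an unvisited edge becomes a link, so the total degree is unchanged and
the exponent `m - 1` grows by at most one (by zero when `m = 0`). -/
lemma linkedWeight_succ_le (e m : ℕ) :
    linkedWeight e (m + 1) ≤ linkedWeight (e + 1) m * 1.0755 := by
  unfold linkedWeight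
  rw [show e + 1 + m = e + (m + 1) by ring, mul_assoc, ← pow_succ]
  have := vertexWeight_pos (e + (m + 1))
  gcongr
  · norm_num
  · omega

/-- The increment 0.1, scaled by the factor 10 in `linkedPathCount_le`, pays for the one route that
a link straight to the target contributes. -/
lemma linkWeight_add_le_succ (k : ℕ) : linkWeight k + 0.1 ≤ linkWeight (k + 1) := by
  match k with
  | 0 | 1 | 2 | 3 => norm_num [linkWeight]
  | n + 4 =>
    simp only [linkWeight, pow_succ]
    have : (1 : ℝ) ≤ 1.23 ^ n := one_le_pow₀ (by norm_num)
    linarith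

lemma linkWeight_add_le (k t : ℕ) : linkWeight k + 0.1 * t ≤ linkWeight (k + t) := by
  induction t with
  | zero => simp
  | succ t ih =>
    have := linkWeight_add_le_succ (k + t)
    rw [← add_assoc]
    push_cast
    linarith

lemma linkWeight_mono : Monotone linkWeight :=
  monotone_nat_of_le_succ fun k => by linarith [linkWeight_add_le_succ k]

lemma linkWeight_nonneg (k : ℕ) : 0 ≤ linkWeight k :=
  linkWeight_mono (Nat.zero_le k)

lemma linkWeight_le_two_mul (k : ℕ) : linkWeight k ≤ 2 * vertexWeight k := by
  match k with
  | 0 | 1 | 2 | 3 => norm_num [linkWeight, vertexWeight]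
  | n + 4 =>
    simp only [linkWeight, vertexWeight, pow_succ]
    have : (0 : ℝ) < 1.23 ^ n := by positivity
    linarith

/-- Equality holds from degree 4 on. The bound fails at `d = 0`, which is why isolated vertices are
excluded. -/
lemma vertexWeight_le {d : ℕ} (hd : 1 ≤ d) :
    vertexWeight d ≤ 1.8629 / 1.23 ^ 4 * 1.23 ^ d := by
  match d with
  | 1 | 2 | 3 => norm_num [vertexWeight]
  | n + 4 =>
    simp only [vertexWeight, pow_add]
    apply le_of_eq
    ring

/-! ### The numeric inequality -/

/-- The contraction factor of a family with `i`, `j`, `l` members of the three extremal types. -/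
noncomputable def contraction (i j l : ℕ) : ℝ :=
  -- The types are singly linked vertices with `e = 2`, `e = 3` and `e ≥ 4`; each factor is
  -- `vertexWeight e / vertexWeight (e + 1)`.
  (1.0755 / 1.467) ^ i * (1.467 / 1.8629) ^ j * (1 / 1.23) ^ l

/-- The normalised total gain of such a family. -/
noncomputable def gain (i j l : ℕ) : ℝ :=
  -- Each coefficient is `linkWeight e / vertexWeight e`; this is constantly 0.984 for `e ≥ 4`,
  -- because 1.49032 * 1.23 = 0.984 * 1.8629.
  i * (1.362 / 1.0755) + j * (1.6 / 1.467) + l * 0.984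

lemma contraction_nonneg (i j l : ℕ) : 0 ≤ contraction i j l := by
  unfold contraction; positivity

lemma gain_nonneg (i j l : ℕ) : 0 ≤ gain i j l := by
  unfold gain; positivity

lemma contraction_add (i j l i' j' l' : ℕ) :
    contraction (i + i') (j + j') (l + l') = contraction i j l * contraction i' j' l' := by
  simp only [contraction, pow_add]; ring

lemma gain_add (i j l i' j' l' : ℕ) :
    gain (i + i') (j + j') (l + l') = gain i j l + gain i' j' l' := by
  simp only [gain]; push_cast; ring

lemma contraction_mul_gain_le_of_le_five {i j l : ℕ} (h : i + j + l ≤ 5) :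
    contraction i j l * gain i j l ≤ linkWeight (i + j + l) := by
  have hi : i ≤ 5 := by omega
  interval_cases i <;>
  (have hj : j ≤ 5 := by omega) <;>
  interval_cases j <;>
  (have hl : l ≤ 5 := by omega) <;>
  interval_cases l <;>
  first
  | (exfalso; omega)
  | norm_num [contraction, gain, linkWeight]

/-- Beyond five members, a further member of any type contracts the product by more than its gain
adds. -/
lemma contraction_mul_gain_le_of_eq_add_five (n : ℕ) :
    ∀ i j l : ℕ, i + j + l = n + 5 → contraction i j l * gain i j l ≤ linkWeight 5 := by
  induction n with
  | zero =>
    intro i j l h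
    rw [← show i + j + l = 5 by omega]
    exact contraction_mul_gain_le_of_le_five (by omega)
  | succ n ih =>
    intro i j l h
    have key : ∀ i j l i' j' l' : ℕ, i + j + l = n + 5 →
        contraction i' j' l' * (4.92 + gain i' j' l') ≤ 4.92 → contraction i' j' l' ≤ 1 →
        contraction (i + i') (j + j') (l + l') * gain (i + i') (j + j') (l + l')
          ≤ linkWeight 5 := by
      intro i j l i' j' l' hs h1 h2
      refine le_trans ?_ (ih i j l hs)
      rw [contraction_add, gain_add]
      -- 4.92 = 5 * 0.984: at least five members, each gaining at least 0.984.
      have hg : 4.92 ≤ gain i j l := by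
        have hs' : (i : ℝ) + j + l = n + 5 := by exact_mod_cast hs
        have hn : (0 : ℝ) ≤ n := n.cast_nonneg
        have hi : (0 : ℝ) ≤ i := i.cast_nonneg
        have hj : (0 : ℝ) ≤ j := j.cast_nonneg
        have a1 : (i : ℝ) * 0.984 ≤ i * (1.362 / 1.0755) := by gcongr; norm_num
        have a2 : (j : ℝ) * 0.984 ≤ j * (1.6 / 1.467) := by gcongr; norm_num
        unfold gain
        linarith
      have hc := contraction_nonneg i j l
      rw [mul_assoc]
      refine mul_le_mul_of_nonneg_left ?_ hc
      nlinarith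
    rcases Nat.eq_zero_or_pos i with hi | hi
    · rcases Nat.eq_zero_or_pos j with hj | hj
      · obtain ⟨l, rfl⟩ : ∃ l', l = l' + 1 := ⟨l - 1, by omega⟩
        exact key i j l 0 0 1 (by omega) (by norm_num [contraction, gain])
          (by norm_num [contraction])
      · obtain ⟨j, rfl⟩ : ∃ j', j = j' + 1 := ⟨j - 1, by omega⟩
        exact key i j l 0 1 0 (by omega) (by norm_num [contraction, gain])
          (by norm_num [contraction])
    · obtain ⟨i, rfl⟩ : ∃ i', i = i' + 1 := ⟨i - 1, by omega⟩
      exact key i j l 1 0 0 (by omega) (by norm_num [contraction, gain])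
        (by norm_num [contraction])

lemma contraction_mul_gain_le (i j l : ℕ) :
    contraction i j l * gain i j l ≤ linkWeight (i + j + l) := by
  rcases le_total (i + j + l) 5 with h | h
  · exact contraction_mul_gain_le_of_le_five h
  · exact (contraction_mul_gain_le_of_eq_add_five (i + j + l - 5) i j l (by omega)).trans
      (linkWeight_mono h)

lemma contraction_zero_zero (m : ℕ) : contraction 0 0 m = (1 / 1.23) ^ m := by
  simp [contraction]

lemma gain_zero_zero (m : ℕ) : gain 0 0 m = m * 0.984 := by
  simp [gain]

/-- Domination by the third extremal type is inherited when a link is added. -/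
lemma dominated_succ {e m : ℕ} (hm : 1 ≤ m) (h4 : 4 ≤ e + m)
    (h1 : vertexWeight e ≤ linkedWeight e m * contraction 0 0 m)
    (h2 : linkWeight e ≤ linkedWeight e m * contraction 0 0 m * 0.984) :
    vertexWeight e ≤ linkedWeight e (m + 1) * contraction 0 0 (m + 1) ∧
      linkWeight e ≤ linkedWeight e (m + 1) * contraction 0 0 (m + 1) * 0.984 := by
  -- The new link multiplies the weight by 1.23 * 1.0755 and the contraction by 1 / 1.23, a net
  -- factor 1.0755.
  have key : linkedWeight e m * contraction 0 0 m ≤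
      linkedWeight e (m + 1) * contraction 0 0 (m + 1) := by
    obtain ⟨n, hn⟩ : ∃ n, e + m = n + 4 := ⟨e + m - 4, by omega⟩
    obtain ⟨q, rfl⟩ : ∃ q, m = q + 1 := ⟨m - 1, by omega⟩
    simp only [linkedWeight, contraction_zero_zero, hn,
      show e + (q + 1 + 1) = (n + 1) + 4 by omega, vertexWeight, Nat.add_sub_cancel]
    have : (0 : ℝ) < 1.8629 * 1.23 ^ n * 1.0755 ^ q * (1 / 1.23) ^ (q + 1) := by positivity
    calc (1.8629 * 1.23 ^ n * 1.0755 ^ q * (1 / 1.23) ^ (q + 1) : ℝ)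
        ≤ 1.0755 * (1.8629 * 1.23 ^ n * 1.0755 ^ q * (1 / 1.23) ^ (q + 1)) := by linarith
      _ = _ := by rw [pow_succ _ n, pow_succ _ q, pow_succ _ (q + 1)]; ring
  exact ⟨h1.trans key, h2.trans (by gcongr)⟩

lemma dominated_of_base {e m₀ : ℕ} (hm : 1 ≤ m₀) (h4 : 4 ≤ e + m₀)
    (h1 : vertexWeight e ≤ linkedWeight e m₀ * contraction 0 0 m₀)
    (h2 : linkWeight e ≤ linkedWeight e m₀ * contraction 0 0 m₀ * 0.984)
    {m : ℕ} (h : m₀ ≤ m) :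
    vertexWeight e ≤ linkedWeight e m * contraction 0 0 m ∧
      linkWeight e ≤ linkedWeight e m * contraction 0 0 m * 0.984 := by
  induction m, h using Nat.le_induction with
  | base => exact ⟨h1, h2⟩
  | succ m hm' ih => exact dominated_succ (hm.trans hm') (by omega) ih.1 ih.2

/-- Every admissible vertex type is dominated by a product of extremal types. -/
lemma exists_dominating {e m : ℕ} (h : m = 0 ∨ (1 ≤ e ∧ 3 ≤ e + m)) :
    ∃ i j l : ℕ, i + j + l = m ∧
      vertexWeight e ≤ linkedWeight e m * contraction i j l ∧
      m * linkWeight e ≤ linkedWeight e m * contraction i j l * gain i j l := by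
  have aux : vertexWeight e ≤ linkedWeight e m * contraction 0 0 m ∧
      linkWeight e ≤ linkedWeight e m * contraction 0 0 m * 0.984 →
      ∃ i j l : ℕ, i + j + l = m ∧
      vertexWeight e ≤ linkedWeight e m * contraction i j l ∧
      m * linkWeight e ≤ linkedWeight e m * contraction i j l * gain i j l := by
    rintro ⟨h1, h2⟩
    refine ⟨0, 0, m, by omega, h1, ?_⟩
    rw [gain_zero_zero]
    calc (m : ℝ) * linkWeight e
        ≤ m * (linkedWeight e m * contraction 0 0 m * 0.984) := by gcongr
      _ = _ := by ring
  rcases Nat.eq_zero_or_pos m with rfl | hm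
  · exact ⟨0, 0, 0, rfl, by simp [linkedWeight, contraction], by simp [gain]⟩
  obtain ⟨he, h3⟩ := h.resolve_left hm.ne'
  match e, he with
  | 1, _ =>
    -- With two links the total degree is 3, below the geometric range that `dominated_of_base`
    -- needs, so this case is checked directly.
    rcases (show 2 ≤ m by omega).eq_or_lt with rfl | h
    · exact aux (by norm_num [vertexWeight, linkWeight, linkedWeight, contraction])
    · exact aux (dominated_of_base (m₀ := 3) (by norm_num) (by norm_num)
        (by norm_num [vertexWeight, linkedWeight, contraction])
        (by norm_num [vertexWeight, linkWeight, linkedWeight, contraction]) h)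
  | 2, _ =>
    rcases (show 1 ≤ m by omega).eq_or_lt with rfl | h
    · exact ⟨1, 0, 0, rfl,
        by norm_num [vertexWeight, linkWeight, linkedWeight, contraction, gain]⟩
    rcases (show 2 ≤ m from h).eq_or_lt with rfl | h
    · exact ⟨1, 1, 0, rfl,
        by norm_num [vertexWeight, linkWeight, linkedWeight, contraction, gain]⟩
    · exact aux (dominated_of_base (m₀ := 3) (by norm_num) (by norm_num)
        (by norm_num [vertexWeight, linkedWeight, contraction])
        (by norm_num [vertexWeight, linkWeight, linkedWeight, contraction]) h)
  | 3, _ =>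
    rcases (show 1 ≤ m by omega).eq_or_lt with rfl | h
    · exact ⟨0, 1, 0, rfl,
        by norm_num [vertexWeight, linkWeight, linkedWeight, contraction, gain]⟩
    · exact aux (dominated_of_base (m₀ := 2) (by norm_num) (by norm_num)
        (by norm_num [vertexWeight, linkedWeight, contraction])
        (by norm_num [vertexWeight, linkWeight, linkedWeight, contraction]) h)
  | n + 4, _ =>
    refine aux (dominated_of_base (m₀ := 1) le_rfl (by omega) ?_ ?_ hm)
    · simp only [linkedWeight, contraction_zero_zero,
        vertexWeight, pow_succ]
      apply le_of_eq
      norm_num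
      ring
    · simp only [linkedWeight, contraction_zero_zero,
        vertexWeight, linkWeight, pow_succ]
      apply le_of_eq
      norm_num
      ring

/-- The branching inequality. -/
theorem sum_mul_prod_vertexWeight_le {ι : Type*} [DecidableEq ι] (S : Finset ι) (e m : ι → ℕ)
    (h : ∀ i ∈ S, m i = 0 ∨ (1 ≤ e i ∧ 3 ≤ e i + m i)) :
    ∑ i ∈ S, m i * linkWeight (e i) * ∏ j ∈ S.erase i, vertexWeight (e j) ≤
      linkWeight (∑ i ∈ S, m i) * ∏ i ∈ S, linkedWeight (e i) (m i) := by
  -- The product bound is carried along because inserting a vertex adds a summand multiplied by the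
  -- old product.
  suffices H : ∃ i j l : ℕ, i + j + l = ∑ i ∈ S, m i ∧
      ∏ i ∈ S, vertexWeight (e i) ≤ contraction i j l * ∏ i ∈ S, linkedWeight (e i) (m i) ∧
      ∑ i ∈ S, m i * linkWeight (e i) * ∏ j ∈ S.erase i, vertexWeight (e j) ≤
        contraction i j l * gain i j l * ∏ i ∈ S, linkedWeight (e i) (m i) by
    obtain ⟨i, j, l, hs, -, h2⟩ := H
    refine h2.trans (mul_le_mul_of_nonneg_right ?_
      (Finset.prod_nonneg fun i _ => (linkedWeight_pos _ _).le))
    rw [← hs]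
    exact contraction_mul_gain_le i j l
  induction S using Finset.induction_on with
  | empty => exact ⟨0, 0, 0, by simp [contraction, gain]⟩
  | insert a S ha ih =>
    obtain ⟨i, j, l, hs, h1, h2⟩ := ih fun i hi => h i (Finset.mem_insert_of_mem hi)
    obtain ⟨i', j', l', hs', h1', h2'⟩ := exists_dominating (h a (Finset.mem_insert_self a S))
    refine ⟨i + i', j + j', l + l', ?_, ?_, ?_⟩
    · rw [Finset.sum_insert ha]; omega
    · rw [Finset.prod_insert ha, Finset.prod_insert ha, contraction_add]
      calc _ ≤ (linkedWeight (e a) (m a) * contraction i' j' l') *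
            (contraction i j l * ∏ i ∈ S, linkedWeight (e i) (m i)) :=
            mul_le_mul h1' h1 (Finset.prod_nonneg fun i _ => (vertexWeight_pos _).le)
              (mul_nonneg (linkedWeight_pos _ _).le (contraction_nonneg _ _ _))
        _ = _ := by ring
    · have hsum : ∑ i ∈ S, m i * linkWeight (e i) *
          ∏ j ∈ (insert a S).erase i, vertexWeight (e j) =
          vertexWeight (e a) *
            ∑ i ∈ S, m i * linkWeight (e i) * ∏ j ∈ S.erase i, vertexWeight (e j) := by
        rw [Finset.mul_sum]
        refine Finset.sum_congr rfl fun i hi => ?_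
        have hia : a ≠ i := fun h => ha (h ▸ hi)
        rw [Finset.erase_insert_of_ne hia, Finset.prod_insert (by simp [ha])]
        ring
      rw [Finset.sum_insert ha, Finset.erase_insert ha, hsum, Finset.prod_insert ha,
        contraction_add, gain_add]
      have hp : 0 ≤ ∏ i ∈ S, vertexWeight (e i) :=
        Finset.prod_nonneg fun i _ => (vertexWeight_pos _).le
      have hq : 0 ≤ ∑ i ∈ S, m i * linkWeight (e i) * ∏ j ∈ S.erase i, vertexWeight (e j) :=
        Finset.sum_nonneg fun i _ => mul_nonneg
          (mul_nonneg (Nat.cast_nonneg _) (linkWeight_nonneg _))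
          (Finset.prod_nonneg fun i _ => (vertexWeight_pos _).le)
      have hc := contraction_nonneg i' j' l'
      have hw := (linkedWeight_pos (e a) (m a)).le
      have hg := gain_nonneg i' j' l'
      calc _ ≤ (linkedWeight (e a) (m a) * contraction i' j' l' * gain i' j' l') *
              (contraction i j l * ∏ i ∈ S, linkedWeight (e i) (m i)) +
            (linkedWeight (e a) (m a) * contraction i' j' l') *
              (contraction i j l * gain i j l * ∏ i ∈ S, linkedWeight (e i) (m i)) :=
            add_le_add (mul_le_mul h2' h1 hp (by positivity))
              (mul_le_mul h1' h2 hq (by positivity))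
        _ = _ := by ring

end CycleBound

/-! ### Counting self-avoiding routes; deletion and suppression of vertices -/

namespace SimpleGraph

open CycleBound

variable {V : Type u} (G : SimpleGraph V) [DecidableRel G.Adj]

/-- The indicator function of the neighbourhood of `v`. -/
def adjIndicator (v w : V) : ℕ := if G.Adj v w then 1 else 0

/-- The number of neighbours of `v` in `U`. -/
def degreeIn (U : Finset V) (v : V) : ℕ := ∑ w ∈ U, G.adjIndicator v w

lemma adjIndicator_comm (v w : V) : G.adjIndicator v w = G.adjIndicator w v := by
  simp [adjIndicator, G.adj_comm]

lemma adjIndicator_self (v : V) : G.adjIndicator v v = 0 := by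
  simp [adjIndicator]

lemma adjIndicator_le_one (v w : V) : G.adjIndicator v w ≤ 1 := by
  unfold adjIndicator; split_ifs <;> simp

variable [DecidableEq V]

/-- The number of ways to reach `s` from a vertex with `m w` links to each `w ∈ U`, visiting every
vertex of `U` at most once. -/
def linkedPathCount (s : V) (U : Finset V) (m : V → ℕ) : ℕ :=
  ∑ v ∈ U.attach, m v * if (v : V) = s then 1 else
    linkedPathCount s (U.erase v) (G.adjIndicator v)
termination_by U.card
decreasing_by exact Finset.card_erase_lt_of_mem v.2

/-- The number of ways to continue to `s` after stepping to `v ∈ U`. -/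
def continuationCount (s : V) (U : Finset V) (v : V) : ℕ :=
  if v = s then 1 else G.linkedPathCount s (U.erase v) (G.adjIndicator v)

lemma linkedPathCount_eq_sum (s : V) (U : Finset V) (m : V → ℕ) :
    G.linkedPathCount s U m = ∑ v ∈ U, m v * G.continuationCount s U v := by
  rw [linkedPathCount, ← Finset.sum_attach U]
  rfl

lemma continuationCount_of_ne {s v : V} (h : v ≠ s) (U : Finset V) :
    G.continuationCount s U v = G.linkedPathCount s (U.erase v) (G.adjIndicator v) :=
  if_neg h

/-- Stepping to `v` turns an unvisited edge at `w` into a link, so the total degree of `w` is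
conserved. -/
lemma degreeIn_erase_add {U : Finset V} {v : V} (hv : v ∈ U) (w : V) :
    G.degreeIn (U.erase v) w + G.adjIndicator v w = G.degreeIn U w := by
  rw [adjIndicator_comm, degreeIn, degreeIn, Finset.sum_erase_add _ _ hv]

lemma degreeIn_erase_le (U : Finset V) (v w : V) :
    G.degreeIn (U.erase v) w ≤ G.degreeIn U w :=
  Finset.sum_le_sum_of_subset (Finset.erase_subset v U)

lemma degreeIn_erase_self (U : Finset V) (v : V) :
    G.degreeIn (U.erase v) v = G.degreeIn U v := by
  by_cases hv : v ∈ U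
  · have := G.degreeIn_erase_add hv v
    rwa [adjIndicator_self] at this
  · rw [Finset.erase_eq_of_notMem hv]

lemma linkedPathCount_eq_zero {s : V} {U : Finset V} {m : V → ℕ} (h : ∀ v ∈ U, m v = 0) :
    G.linkedPathCount s U m = 0 := by
  rw [linkedPathCount_eq_sum]
  exact Finset.sum_eq_zero fun v hv => by rw [h v hv, zero_mul]

lemma continuationCount_eq_zero {s : V} {U : Finset V} {a : V} (ha : a ≠ s)
    (h : G.degreeIn U a = 0) : G.continuationCount s U a = 0 := by
  rw [continuationCount_of_ne G ha]
  apply linkedPathCount_eq_zero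
  rw [← degreeIn_erase_self, degreeIn, Finset.sum_eq_zero_iff] at h
  exact h

lemma linkedPathCount_le_erase_add (s : V) {U : Finset V} (m : V → ℕ) {a : V} (haU : a ∈ U)
    (h : ∀ v ∈ U, v ≠ a → G.continuationCount s U v ≤ G.continuationCount s (U.erase a) v) :
    G.linkedPathCount s U m ≤
      G.linkedPathCount s (U.erase a) m + m a * G.continuationCount s U a := by
  rw [linkedPathCount_eq_sum, linkedPathCount_eq_sum, ← Finset.sum_erase_add _ _ haU]
  gcongr with v hv
  exact h v (Finset.mem_of_mem_erase hv) (Finset.ne_of_mem_erase hv)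

/-- A vertex of degree at most one other than the target may be deleted. -/
lemma linkedPathCount_le_erase {s a : V} (ha : a ≠ s) (U : Finset V) (m : V → ℕ)
    (h : G.degreeIn U a + m a ≤ 1) :
    G.linkedPathCount s U m ≤ G.linkedPathCount s (U.erase a) m := by
  induction hn : U.card using Nat.strong_induction_on generalizing U m with
  | _ n ih =>
    by_cases haU : a ∈ U
    · refine (G.linkedPathCount_le_erase_add s m haU fun v hv hva => ?_).trans_eq ?_
      · unfold continuationCount
        split_ifs
        · exact le_rfl
        · rw [Finset.erase_right_comm]
          refine ih _ ?_ _ _ ?_ rfl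
          · rw [← hn]; exact Finset.card_erase_lt_of_mem hv
          · rw [degreeIn_erase_add G hv]; omega
      · rcases Nat.eq_zero_or_pos (m a) with h0 | h0
        · simp [h0]
        · simp [G.continuationCount_eq_zero ha (show G.degreeIn U a = 0 by omega)]
    · rw [Finset.erase_eq_of_notMem haU]

/-- A route that goes through `v` first would enter `a` by its only edge and be stuck there. -/
lemma continuationCount_le_erase {s a : V} (ha : a ≠ s) {U : Finset V}
    (h : G.degreeIn U a ≤ 1) {v : V} (hv : v ∈ U) :
    G.continuationCount s U v ≤ G.continuationCount s (U.erase a) v := by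
  unfold continuationCount
  split_ifs
  · exact le_rfl
  · rw [Finset.erase_right_comm]
    refine G.linkedPathCount_le_erase ha _ _ ?_
    rwa [degreeIn_erase_add G hv]

/-- A vertex without unvisited neighbours other than the target may be deleted. -/
lemma linkedPathCount_le_erase_of_degreeIn_eq_zero {s a : V} (ha : a ≠ s) {U : Finset V}
    (haU : a ∈ U) (m : V → ℕ) (h : G.degreeIn U a = 0) :
    G.linkedPathCount s U m ≤ G.linkedPathCount s (U.erase a) m := by
  refine (G.linkedPathCount_le_erase_add s m haU fun v hv _ =>
    G.continuationCount_le_erase ha (by omega) hv).trans_eq ?_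
  simp [G.continuationCount_eq_zero ha h]

/-- A linked vertex with a single unvisited neighbour `x` may be suppressed. -/
lemma linkedPathCount_le_suppress {s a : V} (ha : a ≠ s) {U : Finset V} (haU : a ∈ U)
    (m : V → ℕ) (hm : m a = 1) {x : V}
    (hx : ∀ w ∈ U, G.adjIndicator a w = if w = x then 1 else 0) (hxU : x ∈ U) :
    G.linkedPathCount s U m ≤
      G.linkedPathCount s (U.erase a) (fun w => m w + if w = x then 1 else 0) := by
  have hd : G.degreeIn U a ≤ 1 := by
    rw [degreeIn, Finset.sum_congr rfl hx]
    simp [hxU]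
  refine (G.linkedPathCount_le_erase_add s m haU fun v hv _ =>
    G.continuationCount_le_erase ha hd hv).trans_eq ?_
  rw [hm, one_mul, continuationCount_of_ne G ha, linkedPathCount_eq_sum, linkedPathCount_eq_sum,
    linkedPathCount_eq_sum, ← Finset.sum_add_distrib]
  refine Finset.sum_congr rfl fun w hw => ?_
  rw [hx w (Finset.mem_of_mem_erase hw), add_mul]

lemma exists_unique_adj_of_degreeIn_eq_one {U : Finset V} {a : V} (h : G.degreeIn U a = 1) :
    ∃ x ∈ U, x ≠ a ∧ ∀ w ∈ U, G.adjIndicator a w = if w = x then 1 else 0 := by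
  have hc : (U.filter (G.Adj a)).card = 1 := by
    rw [← h, degreeIn, Finset.card_filter]; rfl
  obtain ⟨x, hx⟩ := Finset.card_eq_one.mp hc
  have hmem : ∀ w, w ∈ U ∧ G.Adj a w ↔ w = x := fun w => by
    rw [← Finset.mem_filter, hx, Finset.mem_singleton]
  have hxx := (hmem x).mpr rfl
  refine ⟨x, hxx.1, hxx.2.ne', fun w hw => ?_⟩
  have := hmem w
  simp only [hw, true_and] at this
  simp [adjIndicator, this]

/-! ### The potential and the main induction -/

/-- The total weight of the unvisited vertices. -/
noncomputable def unvisitedWeight (s : V) (U : Finset V) (m : V → ℕ) : ℝ :=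
  ∏ v ∈ U.erase s, linkedWeight (G.degreeIn U v) (m v)

lemma one_le_unvisitedWeight (s : V) (U : Finset V) (m : V → ℕ) :
    1 ≤ G.unvisitedWeight s U m :=
  Finset.one_le_prod fun _ _ => one_le_linkedWeight _ _

lemma unvisitedWeight_erase_le (s : V) (U : Finset V) (m : V → ℕ) (a : V) :
    G.unvisitedWeight s (U.erase a) m ≤ G.unvisitedWeight s U m := by
  unfold unvisitedWeight
  calc _ ≤ ∏ v ∈ (U.erase a).erase s, linkedWeight (G.degreeIn U v) (m v) :=
        Finset.prod_le_prod (fun v _ => (linkedWeight_pos _ _).le) fun v _ =>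
          linkedWeight_mono_left (G.degreeIn_erase_le U a v) _
    _ ≤ _ := by
        rw [Finset.erase_right_comm]
        by_cases h : a ∈ U.erase s
        · rw [← Finset.prod_erase_mul _ _ h]
          exact le_mul_of_one_le_right (Finset.prod_nonneg fun v _ => (linkedWeight_pos _ _).le)
            (one_le_linkedWeight _ _)
        · rw [Finset.erase_eq_of_notMem h]

lemma unvisitedWeight_suppress_le {s a : V} (ha : a ≠ s) {U : Finset V} (haU : a ∈ U)
    (m : V → ℕ) (hm : m a = 1) (hd : G.degreeIn U a = 1) {x : V}
    (hx : ∀ w ∈ U, G.adjIndicator a w = if w = x then 1 else 0) :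
    G.unvisitedWeight s (U.erase a) (fun w => m w + if w = x then 1 else 0) ≤
      G.unvisitedWeight s U m := by
  unfold unvisitedWeight
  have haS : a ∈ U.erase s := Finset.mem_erase.mpr ⟨ha, haU⟩
  have hnn : 0 ≤ ∏ v ∈ (U.erase s).erase a, linkedWeight (G.degreeIn U v) (m v) :=
    Finset.prod_nonneg fun v _ => (linkedWeight_pos _ _).le
  rw [Finset.erase_right_comm, ← Finset.prod_erase_mul _ _ haS]
  calc _ ≤ ∏ v ∈ (U.erase s).erase a,
          linkedWeight (G.degreeIn U v) (m v) * (if v = x then 1.0755 else 1) := by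
        refine Finset.prod_le_prod (fun v _ => (linkedWeight_pos _ _).le) fun v hv => ?_
        have hvU : v ∈ U := Finset.mem_of_mem_erase (Finset.mem_of_mem_erase hv)
        have hdeg := G.degreeIn_erase_add haU v
        rw [hx v hvU] at hdeg
        split_ifs at hdeg ⊢ with hvx
        · rw [← hdeg]
          simpa [hvx] using linkedWeight_succ_le (G.degreeIn (U.erase a) v) (m v)
        · simp [hvx, ← hdeg]
    _ = (∏ v ∈ (U.erase s).erase a, linkedWeight (G.degreeIn U v) (m v)) *
          ∏ v ∈ (U.erase s).erase a, (if v = x then 1.0755 else 1) := Finset.prod_mul_distrib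
    _ ≤ _ := by
        refine mul_le_mul_of_nonneg_left ?_ hnn
        rw [Finset.prod_ite_eq', hd, hm]
        -- The suppressed vertex had weight `vertexWeight 2` = 1.0755, exactly the factor charged to
        -- `x`; nothing is charged if `x` is the target.
        split_ifs <;> norm_num [linkedWeight, vertexWeight]

/-- After a step the old links are forgotten and the new ones are simple, so the potential takes the
form on the left of the branching inequality. -/
lemma unvisitedWeight_adjIndicator {s : V} {U : Finset V} {v : V} (hv : v ∈ U) :
    G.unvisitedWeight s (U.erase v) (G.adjIndicator v) =
      ∏ w ∈ (U.erase s).erase v, vertexWeight (G.degreeIn U w) := by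
  unfold unvisitedWeight
  rw [Finset.erase_right_comm]
  refine Finset.prod_congr rfl fun w _ => ?_
  rw [linkedWeight_of_le_one _ (G.adjIndicator_le_one v w), degreeIn_erase_add G hv]

theorem linkedPathCount_le (s : V) (U : Finset V) (m : V → ℕ) :
    (G.linkedPathCount s U m : ℝ) ≤
      10 * (linkWeight (∑ v ∈ U, m v) * G.unvisitedWeight s U m) := by
  induction hn : U.card using Nat.strong_induction_on generalizing U m with
  | _ n ih =>
    have hcard : ∀ a ∈ U, (U.erase a).card < n := fun a ha =>
      hn ▸ Finset.card_erase_lt_of_mem ha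
    by_cases h0 : ∃ a ∈ U, a ≠ s ∧ G.degreeIn U a = 0
    · obtain ⟨a, haU, has, hd⟩ := h0
      calc (G.linkedPathCount s U m : ℝ) ≤ G.linkedPathCount s (U.erase a) m :=
            mod_cast G.linkedPathCount_le_erase_of_degreeIn_eq_zero has haU m hd
        _ ≤ 10 * (linkWeight (∑ v ∈ U.erase a, m v) * G.unvisitedWeight s (U.erase a) m) :=
            ih _ (hcard a haU) _ _ rfl
        _ ≤ _ := by
            gcongr
            · exact zero_le_one.trans (G.one_le_unvisitedWeight _ _ _)
            · exact linkWeight_nonneg _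
            · exact linkWeight_mono (Finset.sum_le_sum_of_subset (Finset.erase_subset _ _))
            · exact G.unvisitedWeight_erase_le s U m a
    by_cases h1 : ∃ a ∈ U, a ≠ s ∧ m a = 1 ∧ G.degreeIn U a = 1
    · obtain ⟨a, haU, has, hm, hd⟩ := h1
      obtain ⟨x, hxU, hxa, hx⟩ := G.exists_unique_adj_of_degreeIn_eq_one hd
      have hsum : ∑ v ∈ U.erase a, (m v + if v = x then 1 else 0) = ∑ v ∈ U, m v := by
        rw [Finset.sum_add_distrib, ← Finset.sum_erase_add _ _ haU, hm]
        simp [hxU, hxa]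
      calc (G.linkedPathCount s U m : ℝ) ≤
            G.linkedPathCount s (U.erase a) (fun w => m w + if w = x then 1 else 0) :=
            mod_cast G.linkedPathCount_le_suppress has haU m hm hx hxU
        _ ≤ 10 * (linkWeight (∑ v ∈ U.erase a, (m v + if v = x then 1 else 0)) *
              G.unvisitedWeight s (U.erase a) (fun w => m w + if w = x then 1 else 0)) :=
            ih _ (hcard a haU) _ _ rfl
        _ ≤ _ := by
            rw [hsum]
            gcongr
            · exact linkWeight_nonneg _
            · exact G.unvisitedWeight_suppress_le has haU m hm hd hx
    push Not at h0 h1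
    have hW := G.one_le_unvisitedWeight s U m
    have hstep : ∑ v ∈ U.erase s, (m v * G.continuationCount s U v : ℝ) ≤
        10 * (linkWeight (∑ v ∈ U.erase s, m v) * G.unvisitedWeight s U m) := by
      refine le_trans ?_ (mul_le_mul_of_nonneg_left (sum_mul_prod_vertexWeight_le (U.erase s)
        (G.degreeIn U) m fun v hv => ?_) (by norm_num))
      · rw [Finset.mul_sum]
        refine Finset.sum_le_sum fun v hv => ?_
        have hvs := Finset.ne_of_mem_erase hv
        have hvU := Finset.mem_of_mem_erase hv
        have := ih _ (hcard v hvU) _ (G.adjIndicator v) rfl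
        rw [← continuationCount_of_ne G hvs, unvisitedWeight_adjIndicator G hvU, ← degreeIn,
          degreeIn_erase_self] at this
        calc (m v * G.continuationCount s U v : ℝ) ≤ m v * (10 * (linkWeight (G.degreeIn U v) *
              ∏ w ∈ (U.erase s).erase v, vertexWeight (G.degreeIn U w))) := by gcongr
          _ = _ := by ring
      · have h2 := h0 v (Finset.mem_of_mem_erase hv) (Finset.ne_of_mem_erase hv)
        have h3 := h1 v (Finset.mem_of_mem_erase hv) (Finset.ne_of_mem_erase hv)
        omega
    rw [linkedPathCount_eq_sum]
    push_cast
    by_cases hs : s ∈ U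
    · rw [← Finset.sum_erase_add _ _ hs, ← Finset.sum_erase_add _ _ hs]
      -- Each link to `s` gives one route and raises the bound by at least 10 * 0.1 = 1, as the
      -- unvisited weight is at least 1.
      have h2 := linkWeight_add_le (∑ v ∈ U.erase s, m v) (m s)
      have h3 : (0 : ℝ) ≤ m s := Nat.cast_nonneg _
      have h4 : (G.continuationCount s U s : ℝ) = 1 := by simp [continuationCount]
      rw [h4]
      nlinarith
    · rw [Finset.erase_eq_of_notMem hs] at hstep
      exact hstep

end SimpleGraph

/-! ### From paths and cycles to the potential -/

namespace SimpleGraph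

open CycleBound

section

variable {V : Type u} [DecidableEq V] (G : SimpleGraph V) [DecidableRel G.Adj]

/-- Paths to `s` through `U` whose first step lies in `M` are counted by `linkedPathCount`. -/
lemma encard_paths_le_linkedPathCount {s : V} (U : Finset V) {v : V} (hvs : v ≠ s) (M : Finset V)
    (hM : M ⊆ U) :
    {p : G.Walk v s | p.IsPath ∧ (∀ w ∈ p.support.tail, w ∈ U) ∧ p.snd ∈ M}.encard ≤
      G.linkedPathCount s U (fun w => if w ∈ M then G.adjIndicator v w else 0) := by
  induction hn : U.card using Nat.strong_induction_on generalizing U v M with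
  | _ n ih =>
    have hsub : {p : G.Walk v s | p.IsPath ∧ (∀ w ∈ p.support.tail, w ∈ U) ∧ p.snd ∈ M} ⊆
        ⋃ x ∈ U, ⋃ h : G.Adj v x ∧ x ∈ M, Walk.cons h.1 ''
          {q : G.Walk x s | q.IsPath ∧ ∀ w ∈ q.support.tail, w ∈ U.erase x} := by
      rintro p ⟨hp, hU, hpM⟩
      cases p with
      | nil => exact absurd rfl hvs
      | @cons _ x _ h q =>
        rw [Walk.snd_cons] at hpM
        rw [Walk.cons_isPath_iff] at hp
        rw [Walk.support_cons, List.tail_cons] at hU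
        refine Set.mem_biUnion (hU x q.start_mem_support) (Set.mem_iUnion.mpr ⟨⟨h, hpM⟩, q,
          ⟨hp.1, fun w hw => Finset.mem_erase.mpr ⟨?_, hU w (List.mem_of_mem_tail hw)⟩⟩, rfl⟩)
        rintro rfl
        have := hp.1.support_nodup
        rw [← Walk.cons_tail_support, List.nodup_cons] at this
        exact this.1 hw
    refine (Set.encard_le_encard hsub).trans ((Finset.set_encard_biUnion_le _ _).trans ?_)
    rw [linkedPathCount_eq_sum]
    push_cast
    refine Finset.sum_le_sum fun x hx => ?_
    by_cases h : G.Adj v x ∧ x ∈ M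
    · rw [if_pos h.2, adjIndicator, if_pos h.1, Nat.cast_one, one_mul]
      simp only [h, and_self, Set.iUnion_true]
      refine (Set.encard_image_le _ _).trans ?_
      by_cases hxs : x = s
      · subst hxs
        rw [continuationCount, if_pos rfl, Nat.cast_one, Set.encard_le_one_iff]
        rintro p q ⟨hp, -⟩ ⟨hq, -⟩
        rw [(Walk.isPath_iff_nil.mp hp).eq_nil, (Walk.isPath_iff_nil.mp hq).eq_nil]
      · rw [continuationCount_of_ne G hxs]
        have := ih _ (hn ▸ Finset.card_erase_lt_of_mem hx) (U.erase x) hxs (U.erase x)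
          subset_rfl rfl
        refine (Set.encard_le_encard ?_).trans (this.trans_eq ?_)
        · rintro q ⟨hq, hqU⟩
          refine ⟨hq, hqU, hqU _ ?_⟩
          cases q with
          | nil => exact absurd rfl hxs
          | cons h q => simp
        · rw [linkedPathCount_eq_sum, linkedPathCount_eq_sum]
          exact congrArg _ (Finset.sum_congr rfl fun w hw => by rw [if_pos hw])
    · simp [h]

end

variable {V : Type u} [Fintype V] (G : SimpleGraph V) [DecidableRel G.Adj]

lemma sum_adjIndicator (v : V) : ∑ w, G.adjIndicator v w = G.degree v := by
  rw [← G.card_neighborFinset_eq_degree, neighborFinset_eq_filter, Finset.card_filter]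
  rfl

/-- The number of cycles through a given edge is bounded by the product of the vertex weights. -/
lemma encard_paths_avoiding_le {u v : V} (h : G.Adj v u) :
    ∃ N : ℕ, {p : G.Walk u v | p.IsPath ∧ s(v, u) ∉ p.edges}.encard ≤ N ∧
      (N : ℝ) ≤ 20 * ∏ w, vertexWeight (G.degree w) := by
  classical
  set U := Finset.univ.erase u with hU
  -- Having no link to `v` forbids going straight back along the removed edge.
  set m : V → ℕ := fun w => if w ∈ U.erase v then G.adjIndicator u w else 0 with hm
  refine ⟨G.linkedPathCount v U m, ?_, ?_⟩
  · refine le_trans (Set.encard_le_encard ?_)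
      (G.encard_paths_le_linkedPathCount U h.ne' (U.erase v) (Finset.erase_subset _ _))
    rintro p ⟨hp, he⟩
    have hu : u ∉ p.support.tail := by
      have := hp.support_nodup
      rw [← Walk.cons_tail_support, List.nodup_cons] at this
      exact this.1
    have htail : ∀ w ∈ p.support.tail, w ∈ U := fun w hw =>
      Finset.mem_erase.mpr ⟨fun hwu => hu (hwu ▸ hw), Finset.mem_univ _⟩
    refine ⟨hp, htail, Finset.mem_erase.mpr ⟨?_, htail _ ?_⟩⟩
    · rintro hsnd
      cases p with
      | nil => exact h.ne rfl
      | cons h' q =>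
        rw [Walk.snd_cons] at hsnd
        subst hsnd
        simp [Sym2.eq_swap] at he
    · cases p with
      | nil => exact absurd rfl h.ne
      | cons h' q => simp
  · have hmle : ∀ w, m w ≤ G.adjIndicator u w := fun w => by
      simp only [hm]; split_ifs <;> simp
    have hk : ∑ w ∈ U, m w ≤ G.degree u := by
      rw [← sum_adjIndicator]
      exact (Finset.sum_le_sum fun w _ => hmle w).trans
        (Finset.sum_le_sum_of_subset (Finset.subset_univ _))
    have hW : G.unvisitedWeight v U m ≤ ∏ w ∈ Finset.univ.erase u, vertexWeight (G.degree w) := by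
      unfold unvisitedWeight
      have hv : v ∈ U := Finset.mem_erase.mpr ⟨h.ne, Finset.mem_univ _⟩
      calc _ ≤ ∏ w ∈ U.erase v, vertexWeight (G.degree w) := by
            refine Finset.prod_le_prod (fun w _ => (linkedWeight_pos _ _).le) fun w hw => ?_
            rw [linkedWeight_of_le_one _ ((hmle w).trans (G.adjIndicator_le_one u w))]
            refine vertexWeight_mono ((Nat.add_le_add_left (hmle w) _).trans_eq ?_)
            rw [hU, degreeIn_erase_add G (Finset.mem_univ u), degreeIn,
              sum_adjIndicator]
        _ ≤ _ := by
            rw [← Finset.prod_erase_mul _ _ hv]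
            exact le_mul_of_one_le_right (Finset.prod_nonneg fun w _ => (vertexWeight_pos _).le)
              (one_le_vertexWeight _)
    calc (G.linkedPathCount v U m : ℝ)
        ≤ 10 * (linkWeight (∑ w ∈ U, m w) * G.unvisitedWeight v U m) :=
          G.linkedPathCount_le v U m
      _ ≤ 10 * ((2 * vertexWeight (G.degree u)) *
            ∏ w ∈ Finset.univ.erase u, vertexWeight (G.degree w)) := by
          -- This supplies the factor of `u` missing from the product.
          have h1 := (linkWeight_mono hk).trans (linkWeight_le_two_mul (G.degree u))
          have h2 := vertexWeight_pos (G.degree u)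
          have h3 := zero_le_one.trans (G.one_le_unvisitedWeight v U m)
          gcongr
      _ = _ := by
          rw [← Finset.mul_prod_erase _ _ (Finset.mem_univ u)]
          ring

/-- The number of cycles of a graph in terms of its degree sequence. -/
theorem numCycles_le_prod_vertexWeight :
    (G.numCycles : ℝ) ≤ 40 * G.edgeFinset.card * ∏ w, vertexWeight (G.degree w) := by
  classical
  choose! N hN1 hN2 using fun (v u : V) (h : G.Adj v u) => G.encard_paths_avoiding_le h
  have hsub : {H : G.Subgraph | ∃ (v : V) (p : G.Walk v v), p.IsCycle ∧ p.toSubgraph = H} ⊆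
      ⋃ v ∈ (Finset.univ : Finset V), ⋃ u ∈ G.neighborFinset v, ⋃ h : G.Adj v u,
        (fun q => (Walk.cons h q).toSubgraph) ''
          {p : G.Walk u v | p.IsPath ∧ s(v, u) ∉ p.edges} := by
    rintro H ⟨v, p, hp, rfl⟩
    cases p with
    | nil => exact absurd hp Walk.not_isCycle_nil
    | @cons _ u _ h q =>
      exact Set.mem_biUnion (Finset.mem_univ v) (Set.mem_biUnion
        ((G.mem_neighborFinset v u).mpr h)
        (Set.mem_iUnion.mpr ⟨h, q, (Walk.cons_isCycle_iff q h).mp hp, rfl⟩))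
  have hle : {H : G.Subgraph | ∃ (v : V) (p : G.Walk v v), p.IsCycle ∧ p.toSubgraph = H}.encard ≤
      (∑ v, ∑ u ∈ G.neighborFinset v, N v u : ℕ) := by
    refine (Set.encard_le_encard hsub).trans ((Finset.set_encard_biUnion_le _ _).trans ?_)
    push_cast
    refine Finset.sum_le_sum fun v _ => (Finset.set_encard_biUnion_le _ _).trans
      (Finset.sum_le_sum fun u hu => ?_)
    have h := (G.mem_neighborFinset v u).mp hu
    simp only [h, Set.iUnion_true]
    exact (Set.encard_image_le _ _).trans (hN1 v u h)
  have hnum : G.numCycles ≤ ∑ v, ∑ u ∈ G.neighborFinset v, N v u :=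
    (Set.encard_le_coe_iff_finite_ncard_le.mp hle).2
  have hdeg : ((∑ v, G.degree v : ℕ) : ℝ) = 2 * G.edgeFinset.card := by
    exact_mod_cast G.sum_degrees_eq_twice_card_edges
  calc (G.numCycles : ℝ) ≤ ((∑ v, ∑ u ∈ G.neighborFinset v, N v u : ℕ) : ℝ) := mod_cast hnum
    _ ≤ ∑ v, ∑ u ∈ G.neighborFinset v, 20 * ∏ w, vertexWeight (G.degree w) := by
        push_cast
        exact Finset.sum_le_sum fun v _ => Finset.sum_le_sum fun u hu =>
          hN2 v u ((G.mem_neighborFinset v u).mp hu)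
    _ = 20 * ((∑ v, G.degree v : ℕ) : ℝ) * ∏ w, vertexWeight (G.degree w) := by
        simp only [Finset.sum_const, card_neighborFinset_eq_degree, nsmul_eq_mul]
        rw [← Finset.sum_mul]
        push_cast
        ring
    _ = _ := by rw [hdeg]; ring

/-! ### Numerical bounds for average degree at most four -/

lemma prod_vertexWeight_le (hd : ∀ v, 1 ≤ G.degree v) (ha : G.averageDegree ≤ 4) :
    ∏ w, vertexWeight (G.degree w) ≤ 1.3649 ^ G.edgeFinset.card := by
  have hdeg : ∑ v, G.degree v = 2 * G.edgeFinset.card := G.sum_degrees_eq_twice_card_edges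
  have hm : G.edgeFinset.card ≤ Fintype.card V * 2 := by
    rcases isEmpty_or_nonempty V with hV | hV
    · simp only [Finset.univ_eq_empty, Finset.sum_empty] at hdeg
      omega
    · have hpos : (0 : ℝ) < Fintype.card V := mod_cast Fintype.card_pos
      rw [averageDegree, div_le_iff₀ hpos] at ha
      have : ∑ v, G.degree v ≤ 4 * Fintype.card V := by exact_mod_cast ha
      omega
  have hnn : 0 ≤ ∏ w, vertexWeight (G.degree w) :=
    Finset.prod_nonneg fun w _ => (vertexWeight_pos _).le
  -- Squaring avoids the exponent m/2.
  refine le_of_sq_le_sq ?_ (by positivity)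
  calc (∏ w, vertexWeight (G.degree w)) ^ 2
      ≤ (∏ w, 1.8629 / 1.23 ^ 4 * 1.23 ^ G.degree w) ^ 2 := by
        gcongr with w
        · exact fun w _ => (vertexWeight_pos _).le
        · exact vertexWeight_le (hd w)
    _ = (1.8629 / 1.23 ^ 4) ^ (Fintype.card V * 2) * 1.23 ^ (4 * G.edgeFinset.card) := by
        rw [Finset.prod_mul_distrib, Finset.prod_const, Finset.card_univ,
          Finset.prod_pow_eq_pow_sum, hdeg, mul_pow, ← pow_mul, ← pow_mul]
        ring
    _ ≤ (1.8629 / 1.23 ^ 4) ^ G.edgeFinset.card * 1.23 ^ (4 * G.edgeFinset.card) := by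
        refine mul_le_mul_of_nonneg_right ?_ (by positivity)
        -- The base is below 1, so the lower bound on the number of vertices is what helps.
        exact pow_le_pow_of_le_one (by norm_num) (by norm_num) hm
    _ = 1.8629 ^ G.edgeFinset.card := by
        rw [pow_mul, ← mul_pow]
        norm_num
    _ ≤ (1.3649 ^ 2) ^ G.edgeFinset.card := by gcongr; norm_num
    _ = _ := by rw [← pow_mul, ← pow_mul, mul_comm]

/-- A graph without isolated vertices and of average degree at most four has `O(1.365 ^ m)`
cycles. -/
theorem numCycles_le_of_averageDegree_le_four (hd : ∀ v, 1 ≤ G.degree v)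
    (ha : G.averageDegree ≤ 4) :
    (G.numCycles : ℝ) ≤ 546000 * 1.365 ^ G.edgeFinset.card := by
  -- 1.365 / 1.3649 = 1 + 1/13649; Bernoulli absorbs the linear factor, and 40 * 13649 < 546000.
  have hB := one_add_mul_le_pow (show (-2 : ℝ) ≤ 1 / 13649 by norm_num) G.edgeFinset.card
  have hm : (0 : ℝ) ≤ G.edgeFinset.card := Nat.cast_nonneg _
  calc (G.numCycles : ℝ)
      ≤ 40 * G.edgeFinset.card * ∏ w, vertexWeight (G.degree w) :=
        G.numCycles_le_prod_vertexWeight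
    _ ≤ 40 * G.edgeFinset.card * 1.3649 ^ G.edgeFinset.card := by
        gcongr; exact G.prod_vertexWeight_le hd ha
    _ ≤ 546000 * (1 + 1 / 13649) ^ G.edgeFinset.card * 1.3649 ^ G.edgeFinset.card := by
        refine mul_le_mul_of_nonneg_right ?_ (by positivity)
        linarith
    _ = 546000 * 1.365 ^ G.edgeFinset.card := by
        rw [mul_assoc, ← mul_pow]; norm_num

lemma IsRegularOfDegree.averageDegree_le {d : ℕ} {G : SimpleGraph V} [DecidableRel G.Adj]
    (h : G.IsRegularOfDegree d) : G.averageDegree ≤ d := by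
  simp only [averageDegree, h.degree_eq, Finset.sum_const, Finset.card_univ, nsmul_eq_mul]
  exact div_le_of_le_mul₀ (Nat.cast_nonneg _) (Nat.cast_nonneg _) (mul_comm _ _).le

end SimpleGraph

theorem mainTheorem5 :
    (∃ C : ℝ, ∀ (V : Type u) [Fintype V] (G : SimpleGraph V) [DecidableRel G.Adj],
      (∀ v : V, 1 ≤ G.degree v) → G.averageDegree ≤ 4 →
        (G.numCycles : ℝ) ≤ C * (1.365 : ℝ) ^ G.edgeFinset.card) ∧
    (∃ m₀ : ℕ, ∀ (V : Type u) [Fintype V] (G : SimpleGraph V) [DecidableRel G.Adj],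
      G.IsRegularOfDegree 4 → m₀ ≤ G.edgeFinset.card →
        (G.numCycles : ℝ) ≤ (1.99 : ℝ) ^ ((G.edgeFinset.card : ℝ) / 2)) := by
  refine ⟨⟨546000, fun V _ G _ hd ha => G.numCycles_le_of_averageDegree_le_four hd ha⟩, ?_⟩
  -- 1.41 lies between 1.365 and the square root of 1.99, so the constant is eventually absorbed.
  obtain ⟨m₀, hm₀⟩ := pow_unbounded_of_one_lt (546000 : ℝ) (show (1 : ℝ) < 1.41 / 1.365 by norm_num)
  refine ⟨m₀, fun V _ G _ hG hm => ?_⟩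
  have hd : ∀ v, 1 ≤ G.degree v := fun v => by rw [hG.degree_eq v]; norm_num
  have hpow : (1.41 : ℝ) ≤ 1.99 ^ (1 / 2 : ℝ) := by
    rw [← Real.sqrt_eq_rpow]
    exact Real.le_sqrt_of_sq_le (by norm_num)
  calc (G.numCycles : ℝ) ≤ 546000 * 1.365 ^ G.edgeFinset.card :=
        G.numCycles_le_of_averageDegree_le_four hd (mod_cast hG.averageDegree_le)
    _ ≤ (1.41 / 1.365) ^ G.edgeFinset.card * 1.365 ^ G.edgeFinset.card := by
        refine mul_le_mul_of_nonneg_right ?_ (by positivity)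
        exact hm₀.le.trans (pow_le_pow_right₀ (by norm_num) hm)
    _ = 1.41 ^ G.edgeFinset.card := by
        rw [← mul_pow]; norm_num
    _ ≤ (1.99 ^ (1 / 2 : ℝ)) ^ G.edgeFinset.card := by gcongr
    _ = 1.99 ^ ((G.edgeFinset.card : ℝ) / 2) := by
        rw [← Real.rpow_natCast, ← Real.rpow_mul (by norm_num)]
        congr 1
        ring
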